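/- A semigroup variety is the class of all semigroups satisfying some given system of identities $u \approx v$, where $u, v$ are elements of the free semigroup over a countably infinite alphabet. Semigroup varieties form a lattice in which $\mathbf X \wedge \mathbf Y$ is the intersection of $\mathbf X$ and $\mathbf Y$, and $\mathbf X \vee \mathbf Y$ is the variety generated by their union. A semigroup variety is called overcommutative if it contains all commutative semigroups; the overcommutative varieties form a sublattice $\mathbb{OC}$. An element $x$ of a lattice $L$ is called - neutral if, for all $y,z\in L$, the sublattice of $L$ generated by $x,y,z$ is distributive; - standard if $(x\vee y)\wedge z=(x\wedge z)\vee(y\wedge z)$ for all $y,z\in L$; - costandard if $(x\wedge y)\vee z=(x\vee z)\wedge(y\vee z)$ for all $y,z\in L$; - distributive if $x\vee(y\wedge z)=(x\vee y)\wedge(x\vee z)$ for all $y,z\in L$; - codistributive if $x\wedge(y\vee z)=(x\wedge y)\vee(x\wedge z)$ for all $y,z\in L$; - cancellable if, for all $y,z\in L$, $x\vee y=x\vee z$ and $x\wedge y=x\wedge z$ imply $y=z$. **Corollary 2.3.** For an overcommutative semigroup variety $\mathbf V$, the following are equivalent: a) $\mathbf V$ is a neutral element of the lattice $\mathbb{OC}$;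 b) $\mathbf V$ is a standard element of the lattice $\mathbb{OC}$; c) $\mathbf V$ is a costandard element of the lattice $\mathbb{OC}$; d) $\mathbf V$ is a distributive element of the lattice $\mathbb{OC}$; e) $\mathbf V$ is a codistributive element of the lattice $\mathbb{OC}$; f) $\mathbf V$ is a cancellable element of the lattice $\mathbb{OC}$. -/

import Mathlib

universe u

section SpecialElements

variable {L : Type*} [Lattice L]

/-- `x` is cancellable: an element `y` is determined by the join and the meet of `x` and `y`. -/
def IsCancellableElement (x : L) : Prop :=
  ∀ y z : L, x ⊔ y = x ⊔ z → x ⊓ y = x ⊓ z → y = z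

def IsDistributiveElement (x : L) : Prop :=
  ∀ y z : L, x ⊔ (y ⊓ z) = (x ⊔ y) ⊓ (x ⊔ z)

/-- The dual of `IsDistributiveElement`. -/
def IsCodistributiveElement (x : L) : Prop :=
  ∀ y z : L, x ⊓ (y ⊔ z) = (x ⊓ y) ⊔ (x ⊓ z)

def IsStandardElement (x : L) : Prop :=
  ∀ y z : L, (x ⊔ y) ⊓ z = (x ⊓ z) ⊔ (y ⊓ z)

/-- The dual of `IsStandardElement`. -/
def IsCostandardElement (x : L) : Prop :=
  ∀ y z : L, (x ⊓ y) ⊔ z = (x ⊔ z) ⊓ (y ⊔ z)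

/-- `x` is neutral: for all `y` and `z`, the sublattice generated by `x`, `y`, `z`
(`latticeClosure {x, y, z}`) is a distributive lattice. -/
def IsNeutralElement (x : L) : Prop :=
  ∀ y z : L, ∀ a ∈ latticeClosure {x, y, z}, ∀ b ∈ latticeClosure {x, y, z},
    ∀ c ∈ latticeClosure {x, y, z}, a ⊓ (b ⊔ c) = (a ⊓ b) ⊔ (a ⊓ c)

end SpecialElements

/-- A semigroup identity `𝐮 ≈ 𝐯`: a pair of elements of the free semigroup over a countably
infinite alphabet. -/
abbrev SemigroupIdentity : Type := FreeSemigroup ℕ × FreeSemigroup ℕ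

/-- `S` satisfies `𝐮 ≈ 𝐯`: the two words take the same value under every substitution of elements
of `S` for the letters, i.e. under every homomorphism from the free semigroup to `S`. -/
def SemigroupIdentity.HoldsIn (e : SemigroupIdentity) (S : Semigrp.{u}) : Prop :=
  ∀ φ : FreeSemigroup ℕ →ₙ* S, φ e.1 = φ e.2

/-- The class of all semigroups that satisfy every identity in `E`. -/
def semigroupModels (E : Set SemigroupIdentity) : Set Semigrp.{u} :=
  {S | ∀ e ∈ E, e.HoldsIn S}

/-- The set of all identities that hold in every member of the class `K`. -/
def identitiesOf (K : Set Semigrp.{u}) : Set SemigroupIdentity :=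
  {e | ∀ S ∈ K, e.HoldsIn S}

/-- A semigroup variety: a class of semigroups given by some system of identities. (The empty
semigroup, which Mathlib admits, satisfies every identity. It therefore lies in every variety and
has no influence on inclusions, meets and joins.) -/
@[ext]
structure SemigroupVariety where
  carrier : Set Semigrp.{u}
  equational : ∃ E : Set SemigroupIdentity, carrier = semigroupModels E

namespace SemigroupVariety

instance : PartialOrder SemigroupVariety.{u} :=
  PartialOrder.lift carrier fun _ _ h => SemigroupVariety.ext h

/-- The variety generated by a class `K` of semigroups: the smallest variety that includes `K`
(see `isLeast_generate`). -/
def generate (K : Set Semigrp.{u}) : SemigroupVariety.{u} where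
  carrier := semigroupModels (identitiesOf K)
  equational := ⟨_, rfl⟩

theorem isLeast_generate (K : Set Semigrp.{u}) :
    IsLeast {V : SemigroupVariety.{u} | K ⊆ V.carrier} (generate K) := by
  refine ⟨fun S hS e he => he S hS, ?_⟩
  rintro ⟨C, E, rfl⟩ hV S hS e he
  exact hS e fun T hT => hV hT e he

/-- The lattice of semigroup varieties: the order is inclusion of classes, the meet is the
intersection, the join is the variety generated by the union. -/
instance : Lattice SemigroupVariety.{u} where
  sup V W := generate (V.carrier ∪ W.carrier)
  le_sup_left V W := fun _ hS => (isLeast_generate (V.carrier ∪ W.carrier)).1 (Or.inl hS)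
  le_sup_right V W := fun _ hS => (isLeast_generate (V.carrier ∪ W.carrier)).1 (Or.inr hS)
  sup_le V W U hV hW :=
    (isLeast_generate (V.carrier ∪ W.carrier)).2 fun _ hS => hS.elim (fun h => hV h) fun h => hW h
  inf V W :=
    { carrier := V.carrier ∩ W.carrier
      equational := by
        obtain ⟨E, hE⟩ := V.equational
        obtain ⟨E', hE'⟩ := W.equational
        refine ⟨E ∪ E', ?_⟩
        rw [hE, hE']
        ext S
        exact ⟨fun h e he => he.elim (h.1 e) (h.2 e),
          fun h => ⟨fun e he => h e (Or.inl he), fun e he => h e (Or.inr he)⟩⟩ }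
  inf_le_left _ _ := fun _ hS => hS.1
  inf_le_right _ _ := fun _ hS => hS.2
  le_inf _ _ _ h h' := fun _ hS => ⟨h hS, h' hS⟩

/-- `V` is overcommutative: it contains all commutative semigroups. -/
def IsOvercommutative (V : SemigroupVariety.{u}) : Prop :=
  ∀ S : Semigrp.{u}, (∀ a b : S, a * b = b * a) → S ∈ V.carrier

/-- The lattice of overcommutative semigroup varieties, as a sublattice of the lattice of all
semigroup varieties. -/
def OC : Sublattice SemigroupVariety.{u} where
  carrier := {V | V.IsOvercommutative}
  supClosed' V hV W _ S hS := (le_sup_left : V ≤ V ⊔ W) (hV S hS)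
  infClosed' _ hV _ hW S hS := ⟨hV S hS, hW S hS⟩

end SemigroupVariety

/-! Passing to identities turns `OC` upside down into the lattice of content-preserving fully
invariant congruences on the free semigroup (`isOvercommutative_iff`, `identities_ofSetoid`). All
six conditions are equivalent to `IsTrivialOnContents`.

If `V` is trivial on contents, restrict to each content `m`: `component m` exchanges joins and
meets, sends `V` to a bound, and these maps jointly separate varieties. Two elements and the bounds
generate a distributive lattice, so `V` is neutral; the other conditions follow by lattice algebra.

Conversely, let `V` identify `a ≠ b` but separate `a` from some `c` of the same content. A
renaming-invariant equivalence on the words with `n` letters, `k` of them distinct, becomes fully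
invariant once all more complex words of equal content are collapsed (`expand`), so counterexamples
can be built on one level. If a letter repeats, there are at least three renaming orbits, and the
pairs `(a, c)`, `(b, c)` work for suitable `a`, `b`, `c`. If no letter repeats, words are
permutations and the class of `a` is a subgroup; a transposition `t` outside it that fails to
commute with some `h` inside it gives the pairs `(a, ta)`, `(ha, tha)`. Distributivity then fails
through the centralizer of `th`. -/

section LatticeAlgebra

/-! ### Implications valid in every lattice. -/

variable {L : Type*} [Lattice L] {x : L}

theorem IsNeutralElement.inf_sup (h : IsNeutralElement x) (y z : L) {a b c : L}
    (ha : a ∈ ({x, y, z} : Set L)) (hb : b ∈ ({x, y, z} : Set L))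
    (hc : c ∈ ({x, y, z} : Set L)) : a ⊓ (b ⊔ c) = (a ⊓ b) ⊔ (a ⊓ c) :=
  h y z a (subset_latticeClosure ha) b (subset_latticeClosure hb) c (subset_latticeClosure hc)

theorem IsNeutralElement.sup_inf (h : IsNeutralElement x) (y z : L) {a b c : L}
    (ha : a ∈ ({x, y, z} : Set L)) (hb : b ∈ ({x, y, z} : Set L))
    (hc : c ∈ ({x, y, z} : Set L)) : a ⊔ (b ⊓ c) = (a ⊔ b) ⊓ (a ⊔ c) := by
  have hs := isSublattice_latticeClosure (s := ({x, y, z} : Set L))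
  have ha := subset_latticeClosure ha
  have hb := subset_latticeClosure hb
  have hc := subset_latticeClosure hc
  -- The dual law comes from meet-distributivity at `a ⊔ b`, `a`, `c`, hence the need for the whole
  -- closure.
  rw [h y z _ (hs.supClosed ha hb) _ ha _ hc, inf_comm (a ⊔ b) a, inf_sup_self,
    inf_comm (a ⊔ b) c, h y z _ hc _ ha _ hb, ← sup_assoc, inf_comm c a, sup_inf_self,
    inf_comm c b]

theorem IsNeutralElement.isCodistributive (h : IsNeutralElement x) : IsCodistributiveElement x :=
  fun y z => h.inf_sup y z (by simp) (by simp) (by simp)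

theorem IsNeutralElement.isDistributive (h : IsNeutralElement x) : IsDistributiveElement x :=
  fun y z => h.sup_inf y z (by simp) (by simp) (by simp)

theorem IsNeutralElement.isStandard (h : IsNeutralElement x) : IsStandardElement x := by
  intro y z
  rw [inf_comm, inf_comm x, inf_comm y]
  exact h.inf_sup y z (by simp) (by simp) (by simp)

theorem IsNeutralElement.isCostandard (h : IsNeutralElement x) : IsCostandardElement x := by
  intro y z
  rw [sup_comm, sup_comm x, sup_comm y]
  exact h.sup_inf y z (by simp) (by simp) (by simp)

theorem IsStandardElement.isCancellable (h : IsStandardElement x) : IsCancellableElement x := by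
  intro y z h1 h2
  calc y = (x ⊔ z) ⊓ y := by rw [← h1]; simp
    _ = (x ⊓ z) ⊔ (y ⊓ z) := by rw [h, h2, inf_comm z y]
    _ = (x ⊔ y) ⊓ z := (h y z).symm
    _ = z := by rw [h1]; simp

theorem IsCostandardElement.isCancellable (h : IsCostandardElement x) :
    IsCancellableElement x := by
  intro y z h1 h2
  calc y = (x ⊓ z) ⊔ y := by rw [← h2]; simp
    _ = (x ⊔ z) ⊓ (y ⊔ z) := by rw [h, h1, sup_comm z y]
    _ = (x ⊓ y) ⊔ z := (h y z).symm
    _ = z := by rw [h2]; simp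

/-! ### Distributivity of the lattice generated by two elements and the bounds. -/

variable [BoundedOrder L]

/-- The elements of the sublattice generated by `y`, `z` and the two bounds. -/
def boundedClosurePair (y z : L) : Set L := {⊥, ⊤, y, z, y ⊔ z, y ⊓ z}

theorem sup_mem_boundedClosurePair {y z a b : L} (ha : a ∈ boundedClosurePair y z)
    (hb : b ∈ boundedClosurePair y z) : a ⊔ b ∈ boundedClosurePair y z := by
  have h1 : y ⊓ z ⊔ (y ⊔ z) = y ⊔ z := sup_eq_right.2 (inf_le_left.trans le_sup_left)
  have h2 : y ⊔ z ⊔ y ⊓ z = y ⊔ z := sup_eq_left.2 (inf_le_left.trans le_sup_left)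
  have h3 : y ⊔ z ⊔ y = y ⊔ z := sup_eq_left.2 le_sup_left
  have h4 : y ⊓ z ⊔ y = y := sup_eq_right.2 inf_le_left
  have h6 : z ⊔ y = y ⊔ z := sup_comm _ _
  have h5 : z ⊔ y ⊓ z = z := sup_eq_left.2 inf_le_right
  simp only [boundedClosurePair, Set.mem_insert_iff, Set.mem_singleton_iff] at ha hb ⊢
  rcases ha with ha | ha | ha | ha | ha | ha <;>
  rcases hb with hb | hb | hb | hb | hb | hb <;>
  simp [*]

theorem inf_mem_boundedClosurePair {y z a b : L} (ha : a ∈ boundedClosurePair y z)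
    (hb : b ∈ boundedClosurePair y z) : a ⊓ b ∈ boundedClosurePair y z := by
  have h1 : y ⊓ z ⊓ (y ⊔ z) = y ⊓ z := inf_eq_left.2 (inf_le_left.trans le_sup_left)
  have h2 : (y ⊔ z) ⊓ (y ⊓ z) = y ⊓ z := inf_eq_right.2 (inf_le_left.trans le_sup_left)
  have h3 : y ⊓ z ⊓ y = y ⊓ z := inf_eq_left.2 inf_le_left
  have h4 : (y ⊔ z) ⊓ y = y := inf_eq_right.2 le_sup_left
  have h6 : z ⊓ y = y ⊓ z := inf_comm _ _
  have h5 : z ⊓ (y ⊔ z) = z := inf_eq_left.2 le_sup_right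
  simp only [boundedClosurePair, Set.mem_insert_iff, Set.mem_singleton_iff] at ha hb ⊢
  rcases ha with ha | ha | ha | ha | ha | ha <;>
  rcases hb with hb | hb | hb | hb | hb | hb <;>
  simp [*]

set_option maxHeartbeats 1000000 in
theorem inf_sup_of_mem_boundedClosurePair {y z a b c : L} (ha : a ∈ boundedClosurePair y z)
    (hb : b ∈ boundedClosurePair y z) (hc : c ∈ boundedClosurePair y z) :
    a ⊓ (b ⊔ c) = (a ⊓ b) ⊔ (a ⊓ c) := by
  have h1 : y ⊓ z ⊔ (y ⊔ z) = y ⊔ z := sup_eq_right.2 (inf_le_left.trans le_sup_left)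
  have h2 : y ⊔ z ⊔ y ⊓ z = y ⊔ z := sup_eq_left.2 (inf_le_left.trans le_sup_left)
  have h3 : y ⊔ z ⊔ y = y ⊔ z := sup_eq_left.2 le_sup_left
  have h4 : y ⊓ z ⊔ y = y := sup_eq_right.2 inf_le_left
  have h6 : z ⊔ y = y ⊔ z := sup_comm _ _
  have h5 : z ⊔ y ⊓ z = z := sup_eq_left.2 inf_le_right
  have h1' : y ⊓ z ⊓ (y ⊔ z) = y ⊓ z := inf_eq_left.2 (inf_le_left.trans le_sup_left)
  have h2' : (y ⊔ z) ⊓ (y ⊓ z) = y ⊓ z := inf_eq_right.2 (inf_le_left.trans le_sup_left)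
  have h3' : y ⊓ z ⊓ y = y ⊓ z := inf_eq_left.2 inf_le_left
  have h4' : (y ⊔ z) ⊓ y = y := inf_eq_right.2 le_sup_left
  have h6' : z ⊓ y = y ⊓ z := inf_comm _ _
  have h5' : z ⊓ (y ⊔ z) = z := inf_eq_left.2 le_sup_right
  have h7 : y ⊓ z ⊔ z = z := sup_eq_right.2 inf_le_right
  have h8 : z ⊔ (y ⊔ z) = y ⊔ z := sup_eq_right.2 le_sup_right
  have h7' : (y ⊔ z) ⊓ z = z := inf_eq_right.2 le_sup_right
  have h8' : z ⊓ (y ⊓ z) = y ⊓ z := inf_eq_right.2 inf_le_right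
  simp only [boundedClosurePair, Set.mem_insert_iff, Set.mem_singleton_iff] at ha hb hc
  rcases ha with ha | ha | ha | ha | ha | ha <;>
  rcases hb with hb | hb | hb | hb | hb | hb <;>
  rcases hc with hc | hc | hc | hc | hc | hc <;>
  simp only [ha, hb, hc, h1, h2, h3, h4, h5, h6, h1', h2', h3', h4', h5', h6', h7, h8, h7', h8', bot_sup_eq, sup_bot_eq,
    top_sup_eq, sup_top_eq, bot_inf_eq, inf_bot_eq, top_inf_eq, inf_top_eq, sup_idem, inf_idem,
    inf_sup_self, sup_inf_self, sup_left_idem, inf_left_idem, sup_right_idem, inf_right_idem]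

end LatticeAlgebra

/-! ### Words, contents and renamings. -/

namespace FreeSemigroup

def letters (w : FreeSemigroup ℕ) : List ℕ := w.head :: w.tail

theorem letters_injective : Function.Injective letters := by
  rintro ⟨a, l⟩ ⟨b, m⟩ h
  simp only [letters, List.cons.injEq] at h
  exact FreeSemigroup.ext h.1 h.2

@[simp] theorem letters_mul (v w : FreeSemigroup ℕ) :
    (v * w).letters = v.letters ++ w.letters := rfl

@[simp] theorem letters_of (i : ℕ) : (of i).letters = [i] := rfl

theorem exists_letters_eq {l : List ℕ} (h : l ≠ []) : ∃ w : FreeSemigroup ℕ, w.letters = l := by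
  cases l with
  | nil => exact absurd rfl h
  | cons a l => exact ⟨⟨a, l⟩, rfl⟩

theorem letters_ne_nil (w : FreeSemigroup ℕ) : w.letters ≠ [] := List.cons_ne_nil _ _

theorem letters_hom (φ : FreeSemigroup ℕ →ₙ* FreeSemigroup ℕ) (w : FreeSemigroup ℕ) :
    (φ w).letters = w.letters.flatMap fun i => (φ (of i)).letters := by
  induction w using FreeSemigroup.recOnMul with
  | ih1 i => rw [letters_of, List.flatMap_singleton]
  | ih2 x y _ hy =>
    rw [map_mul, letters_mul, hy, letters_mul, List.flatMap_append, letters_of,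
      List.flatMap_singleton]

/-- Renaming of letters. -/
instance : MulAction (Equiv.Perm ℕ) (FreeSemigroup ℕ) where
  smul σ w := FreeSemigroup.map σ w
  one_smul w := by
    change FreeSemigroup.map _ w = w
    induction w using FreeSemigroup.recOnMul with
    | ih1 i => rfl
    | ih2 x y hx hy => rw [map_mul, hx, hy]
  mul_smul σ τ w := by
    change FreeSemigroup.map _ w = FreeSemigroup.map _ (FreeSemigroup.map _ w)
    induction w using FreeSemigroup.recOnMul with
    | ih1 i => rfl
    | ih2 x y hx hy => rw [map_mul, map_mul, map_mul, hx, hy]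

@[simp] theorem letters_smul (σ : Equiv.Perm ℕ) (w : FreeSemigroup ℕ) :
    (σ • w).letters = w.letters.map σ := by
  change (FreeSemigroup.map σ w).letters = _
  rw [letters_hom]
  simp only [map_of, letters_of]
  induction w.letters <;> simp_all

def content (w : FreeSemigroup ℕ) : Multiset ℕ := w.letters

theorem content_eq_iff {u v : FreeSemigroup ℕ} : u.content = v.content ↔ u.letters.Perm v.letters :=
  Multiset.coe_eq_coe

theorem content_mul (u v : FreeSemigroup ℕ) : (u * v).content = u.content + v.content := rfl

theorem content_smul (σ : Equiv.Perm ℕ) (w : FreeSemigroup ℕ) :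
    (σ • w).content = w.content.map σ := by simp [content]

theorem smul_eq_smul_iff {σ τ : Equiv.Perm ℕ} {w : FreeSemigroup ℕ} :
    σ • w = τ • w ↔ ∀ i ∈ w.content, σ i = τ i := by
  rw [← letters_injective.eq_iff]
  simp [content]

theorem smul_eq_smul_of_content_eq {σ τ : Equiv.Perm ℕ} {a b : FreeSemigroup ℕ}
    (h : a.content = b.content) (hσ : σ • a = τ • a) : σ • b = τ • b := by
  rw [smul_eq_smul_iff] at *
  rwa [← h]

theorem content_hom (φ : FreeSemigroup ℕ →ₙ* FreeSemigroup ℕ) (w : FreeSemigroup ℕ) :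
    (φ w).content = w.content.bind fun i => (φ (of i)).content := by
  induction w using FreeSemigroup.recOnMul with
  | ih1 i => simp [content]
  | ih2 x y hx hy => simp [content_mul, hx, hy]

end FreeSemigroup

/-- The symmetric group on `ℕ` is multiply transitive. -/
theorem List.Nodup.exists_perm_map_eq {l l' : List ℕ} (hl : l.Nodup) (hl' : l'.Nodup)
    (h : l.length = l'.length) : ∃ σ : Equiv.Perm ℕ, l.map σ = l' := by
  have := Equiv.Perm.isMultiplyPretransitive ℕ l.length
  obtain ⟨σ, hσ⟩ := MulAction.isMultiplyPretransitive_iff.1 this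
    ⟨fun i => l[i], fun i j hij => by simpa [hl.getElem_inj_iff, Fin.ext_iff] using hij⟩
    ⟨fun i => l'[i], fun i j hij => by simpa [hl'.getElem_inj_iff, Fin.ext_iff] using hij⟩
  refine ⟨σ, List.ext_getElem (by simpa using h) fun i hi hi' => ?_⟩
  have := DFunLike.congr_fun hσ ⟨i, by simpa using hi⟩
  simpa using this

/-! ### Fully invariant relations and varieties. -/

namespace FreeSemigroup

structure IsFullyInvariant (r : Setoid (FreeSemigroup ℕ)) : Prop where
  mul_left : ∀ w, r ≤ r.comap (w * ·)
  mul_right : ∀ w, r ≤ r.comap (· * w)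
  hom : ∀ φ : FreeSemigroup ℕ →ₙ* FreeSemigroup ℕ, r ≤ r.comap φ

/-- The pullback of `r ⊔ s` along a map preserving both relations is an equivalence containing both.
Thus meets of varieties become plain joins of equivalences. -/
theorem IsFullyInvariant.sup {r s : Setoid (FreeSemigroup ℕ)} (hr : IsFullyInvariant r)
    (hs : IsFullyInvariant s) : IsFullyInvariant (r ⊔ s) := by
  have key : ∀ f : FreeSemigroup ℕ → FreeSemigroup ℕ, r ≤ r.comap f → s ≤ s.comap f →
      r ⊔ s ≤ (r ⊔ s).comap f := fun f h1 h2 =>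
    sup_le (fun _ _ h => (le_sup_left : r ≤ r ⊔ s) (h1 h))
      (fun _ _ h => (le_sup_right : s ≤ r ⊔ s) (h2 h))
  exact ⟨fun w => key _ (hr.mul_left w) (hs.mul_left w),
    fun w => key _ (hr.mul_right w) (hs.mul_right w), fun φ => key _ (hr.hom φ) (hs.hom φ)⟩

/-- The congruence associated with a fully invariant equivalence. -/
def IsFullyInvariant.toCon {r : Setoid (FreeSemigroup ℕ)} (hr : IsFullyInvariant r) :
    Con (FreeSemigroup ℕ) :=
  { r with mul' := fun {_ x y _} h1 h2 => r.trans (hr.mul_right y h1) (hr.mul_left x h2) }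

end FreeSemigroup

open FreeSemigroup

namespace SemigroupVariety

/-- The fully invariant congruence of all identities of a variety. -/
def identities (V : SemigroupVariety.{u}) : Setoid (FreeSemigroup ℕ) where
  r u v := (u, v) ∈ identitiesOf V.carrier
  iseqv := ⟨fun _ _ _ _ => rfl, fun h S hS φ => (h S hS φ).symm,
    fun h h' S hS φ => (h S hS φ).trans (h' S hS φ)⟩

theorem isFullyInvariant_identities (V : SemigroupVariety.{u}) :
    IsFullyInvariant V.identities where
  mul_left w u v h S hS φ := by
    have : φ u = φ v := h S hS φ
    simp [this]
  mul_right w u v h S hS φ := by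
    have : φ u = φ v := h S hS φ
    simp [this]
  hom ψ u v h S hS φ := h S hS (φ.comp ψ)

theorem mem_carrier_iff {V : SemigroupVariety.{u}} {S : Semigrp.{u}} :
    S ∈ V.carrier ↔ ∀ u v, V.identities u v → SemigroupIdentity.HoldsIn (u, v) S := by
  refine ⟨fun hS u v h => h S hS, fun h => ?_⟩
  obtain ⟨E, hE⟩ := V.equational
  rw [hE]
  intro e he
  refine h e.1 e.2 fun T hT => ?_
  rw [hE] at hT
  exact hT e he

theorem identities_le_identities_iff {V W : SemigroupVariety.{u}} :
    V.identities ≤ W.identities ↔ W ≤ V :=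
  ⟨fun h _ hS => mem_carrier_iff.2 fun u v huv => mem_carrier_iff.1 hS u v (h huv),
    fun h _ _ huv S hS => huv S (h hS)⟩

/-- The variety given by the identities that hold in `r`. -/
def ofSetoid (r : Setoid (FreeSemigroup ℕ)) : SemigroupVariety.{u} where
  carrier := semigroupModels {e | r e.1 e.2}
  equational := ⟨_, rfl⟩

/-- The quotient by `r` is a model, since a substitution into it lifts to an endomorphism of the
free semigroup; the canonical projection then detects exactly `r`. -/
theorem identities_ofSetoid {r : Setoid (FreeSemigroup ℕ)} (hr : IsFullyInvariant r) :
    (ofSetoid.{u} r).identities = r := by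
  refine le_antisymm (fun u v h => ?_) (fun u v h S hS => hS (u, v) h)
  let c := hr.toCon
  let π : FreeSemigroup ℕ →ₙ* ULift.{u} c.Quotient := ⟨fun w => ⟨(w : c.Quotient)⟩, fun _ _ => rfl⟩
  have hS : Semigrp.of (ULift.{u} c.Quotient) ∈ (ofSetoid.{u} r).carrier := by
    rintro ⟨u, v⟩ huv φ
    have huv : r u v := huv
    let φ' : FreeSemigroup ℕ →ₙ* ULift.{u} c.Quotient := φ
    let ψ : FreeSemigroup ℕ →ₙ* FreeSemigroup ℕ :=
      FreeSemigroup.lift fun i => Quotient.out (φ' (of i)).down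
    have hψ : φ' = π.comp ψ := by
      refine FreeSemigroup.hom_ext (funext fun i => ?_)
      refine ULift.ext _ _ ?_
      exact (Quotient.out_eq (φ' (of i)).down).symm
    change φ' u = φ' v
    rw [hψ]
    exact ULift.ext _ _ (Quotient.sound (hr.hom ψ huv))
  have := h _ hS π
  exact Quotient.exact (congrArg ULift.down this)

theorem isOvercommutative_iff {V : SemigroupVariety.{u}} :
    V.IsOvercommutative ↔ V.identities ≤ Setoid.ker content := by
  constructor
  · intro hV u v h
    let φ : FreeSemigroup ℕ →ₙ* ULift.{u} (Multiplicative (Multiset ℕ)) :=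
      ⟨fun w => ⟨Multiplicative.ofAdd w.content⟩, fun _ _ => rfl⟩
    have := h (Semigrp.of (ULift.{u} (Multiplicative (Multiset ℕ))))
      (hV _ fun a b => ULift.ext _ _ (mul_comm a.down b.down)) φ
    exact congrArg (fun x => Multiplicative.toAdd (ULift.down x)) this
  · intro h S hS
    rw [mem_carrier_iff]
    intro u v huv φ
    have huv : u.content = v.content := h huv
    -- Adjoining a unit allows the value of a word to be written as a `Multiset.prod` over its
    -- content.
    let _ : CommMonoid (WithOne S) :=
      { (inferInstance : Monoid (WithOne S)) with
        mul_comm := by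
          intro a b
          cases a <;> cases b <;> simp [← WithOne.coe_mul, hS] }
    have key : ∀ w : FreeSemigroup ℕ,
        ((φ w : S) : WithOne S) = (w.content.map fun i => ((φ (of i) : S) : WithOne S)).prod := by
      intro w
      induction w using FreeSemigroup.recOnMul with
      | ih1 i => simp [content]
      | ih2 x y hx hy =>
        rw [map_mul, WithOne.coe_mul, hx, hy, content_mul, Multiset.map_add, Multiset.prod_add]
    refine WithOne.coe_injective ?_
    change ((φ u : S) : WithOne S) = ((φ v : S) : WithOne S)
    rw [key, key, huv]

/-! ### Overcommutative varieties and their restrictions to a content. -/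

namespace OC

def idRel (V : OC.{u}) : Setoid (FreeSemigroup ℕ) := V.1.identities

theorem isFullyInvariant_idRel (V : OC.{u}) : IsFullyInvariant (idRel V) :=
  V.1.isFullyInvariant_identities

theorem content_eq (V : OC.{u}) {u v : FreeSemigroup ℕ} (h : idRel V u v) :
    u.content = v.content :=
  isOvercommutative_iff.1 V.2 h

theorem idRel_le (V : OC.{u}) : idRel V ≤ Setoid.ker content :=
  isOvercommutative_iff.1 V.2

theorem exists_idRel_eq {r : Setoid (FreeSemigroup ℕ)} (hr : IsFullyInvariant r)
    (hc : r ≤ Setoid.ker content) : ∃ V : OC.{u}, idRel V = r :=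
  ⟨⟨ofSetoid r, isOvercommutative_iff.2 (by rwa [identities_ofSetoid hr])⟩,
    identities_ofSetoid hr⟩

theorem idRel_le_idRel_iff {V W : OC.{u}} : idRel V ≤ idRel W ↔ W ≤ V :=
  SemigroupVariety.identities_le_identities_iff

theorem idRel_injective : Function.Injective (idRel.{u}) := fun _ _ h =>
  le_antisymm (idRel_le_idRel_iff.1 h.ge) (idRel_le_idRel_iff.1 h.le)

theorem idRel_sup (V W : OC.{u}) : idRel (V ⊔ W) = idRel V ⊓ idRel W := by
  refine le_antisymm (le_inf (idRel_le_idRel_iff.2 le_sup_left)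
    (idRel_le_idRel_iff.2 le_sup_right)) ?_
  rintro u v ⟨h1, h2⟩ S hS φ
  exact hS (u, v) (fun T hT => hT.elim (h1 T) (h2 T)) φ

theorem idRel_inf (V W : OC.{u}) : idRel (V ⊓ W) = idRel V ⊔ idRel W := by
  refine le_antisymm ?_ (sup_le (idRel_le_idRel_iff.2 inf_le_left)
    (idRel_le_idRel_iff.2 inf_le_right))
  obtain ⟨U, hU⟩ := exists_idRel_eq.{u}
    ((isFullyInvariant_idRel V).sup (isFullyInvariant_idRel W))
    (sup_le (idRel_le V) (idRel_le W))
  rw [← hU]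
  refine idRel_le_idRel_iff.2 (le_inf ?_ ?_) <;>
  rw [← idRel_le_idRel_iff, hU]
  exacts [le_sup_left, le_sup_right]

/-- On each set of words with a common content, the identities of `V` form the equality relation or
the universal relation. -/
def IsTrivialOnContents (V : OC.{u}) : Prop :=
  ∀ a b c : FreeSemigroup ℕ, idRel V a b → a ≠ b → a.content = c.content → idRel V a c

/-- The restriction of the identities of `V` to the words of content `m`. -/
def component (m : Multiset ℕ) (V : OC.{u}) : Setoid {w : FreeSemigroup ℕ // w.content = m} :=
  (idRel V).comap Subtype.val

theorem component_sup (m : Multiset ℕ) (V W : OC.{u}) :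
    component m (V ⊔ W) = component m V ⊓ component m W := by
  rw [component, idRel_sup]
  rfl

theorem component_inf (m : Multiset ℕ) (V W : OC.{u}) :
    component m (V ⊓ W) = component m V ⊔ component m W := by
  rw [component, idRel_inf]
  apply le_antisymm
  -- A chain of identities of `V` and `W` never leaves its content class. The equivalence `t`
  -- expresses this without chains.
  · let t : Setoid (FreeSemigroup ℕ) :=
      { r := fun u v => u.content = v.content ∧ ∀ hu : u.content = m, ∀ hv : v.content = m,
          (component m V ⊔ component m W) ⟨u, hu⟩ ⟨v, hv⟩
        iseqv := ⟨fun u => ⟨rfl, fun _ _ => Setoid.refl' _ _⟩,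
          fun h => ⟨h.1.symm, fun hu hv => Setoid.symm' _ (h.2 hv hu)⟩,
          fun h h' => ⟨h.1.trans h'.1, fun hu hv =>
            Setoid.trans' _ (h.2 hu (h.1 ▸ hu)) (h'.2 (h.1 ▸ hu) hv)⟩⟩ }
    have ht : idRel V ⊔ idRel W ≤ t := by
      refine sup_le (fun u v h => ⟨(content_eq V) h, fun hu hv => ?_⟩)
        (fun u v h => ⟨(content_eq W) h, fun hu hv => ?_⟩)
      · exact (le_sup_left : component m V ≤ component m V ⊔ component m W) h
      · exact (le_sup_right : component m W ≤ component m V ⊔ component m W) h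
    exact fun u v h => (ht h).2 u.2 v.2
  · exact sup_le
      (fun u v h => (le_sup_left : idRel V ≤ idRel V ⊔ idRel W) h)
      (fun u v h => (le_sup_right : idRel W ≤ idRel V ⊔ idRel W) h)

theorem eq_of_component_eq {V W : OC.{u}} (h : ∀ m, component m V = component m W) : V = W := by
  refine idRel_injective (le_antisymm (fun u v huv => ?_) (fun u v huv => ?_))
  · have : component u.content V ⟨u, rfl⟩ ⟨v, ((content_eq V) huv).symm⟩ := huv
    rwa [h] at this
  · have : component u.content W ⟨u, rfl⟩ ⟨v, ((content_eq W) huv).symm⟩ := huv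
    rwa [← h] at this

theorem IsTrivialOnContents.component_eq {V : OC.{u}} (h : IsTrivialOnContents V)
    (m : Multiset ℕ) : component m V = ⊥ ∨ component m V = ⊤ := by
  by_contra! hne
  obtain ⟨h1, h2⟩ := hne
  refine h1 (bot_unique fun a b hab => ?_)
  by_contra hne
  have hu : ∀ c : {w : FreeSemigroup ℕ // w.content = m}, component m V a c := fun c =>
    h a b c hab (fun e => hne (Subtype.ext e)) (a.2.trans c.2.symm)
  exact h2 (top_unique fun c d _ => Setoid.trans' _ (Setoid.symm' _ (hu c)) (hu d))

theorem IsTrivialOnContents.isNeutral {V : OC.{u}} (h : IsTrivialOnContents V) :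
    IsNeutralElement V := by
  intro y z a ha b hb c hc
  have key : ∀ m, ∀ x ∈ latticeClosure {V, y, z},
      component m x ∈ boundedClosurePair (component m y) (component m z) := by
    intro m
    refine latticeClosure_min (t := {x | component m x ∈
      boundedClosurePair (component m y) (component m z)}) ?_ ⟨?_, ?_⟩
    · rintro x (rfl | rfl | rfl)
      · rcases h.component_eq m with h | h <;> simp [boundedClosurePair, h]
      · simp [boundedClosurePair]
      · simp [boundedClosurePair]
    · intro p hp q hq
      simpa [component_sup] using inf_mem_boundedClosurePair hp hq
    · intro p hp q hq
      simpa [component_inf] using sup_mem_boundedClosurePair hp hq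
  refine eq_of_component_eq fun m => ?_
  have ha := key m a ha
  have hb := key m b hb
  have hc := key m c hc
  simp only [component_sup, component_inf]
  -- Joins and meets have been exchanged, so the goal is the dual distributive law.
  rw [inf_sup_of_mem_boundedClosurePair (sup_mem_boundedClosurePair ha hb) ha hc,
    inf_comm _ (component m a), inf_sup_self, inf_comm (component m a ⊔ component m b) (component m c),
    inf_sup_of_mem_boundedClosurePair hc ha hb, ← sup_assoc, inf_comm (component m c) (component m a),
    sup_inf_self, inf_comm (component m c) (component m b)]

end OC

end SemigroupVariety

open SemigroupVariety SemigroupVariety.OC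

/-! ### Counterexamples concentrated on one level of complexity. -/

namespace FreeSemigroup

/-- `m` has more than `n` letters with multiplicities, or `n` letters of which fewer than `k` are
distinct. -/
def Exceeds (n k : ℕ) (m : Multiset ℕ) : Prop :=
  n < m.card ∨ m.card = n ∧ m.toFinset.card < k

theorem card_toFinset_content_smul (σ : Equiv.Perm ℕ) (w : FreeSemigroup ℕ) :
    (σ • w).content.toFinset.card = w.content.toFinset.card := by
  rw [content_smul, Multiset.toFinset_map, Finset.card_image_of_injective _ σ.injective]

theorem exceeds_smul_iff {n k : ℕ} (σ : Equiv.Perm ℕ) (w : FreeSemigroup ℕ) :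
    Exceeds n k (σ • w).content ↔ Exceeds n k w.content := by
  rw [Exceeds, Exceeds, card_toFinset_content_smul, content_smul, Multiset.card_map]

theorem card_content_pos (w : FreeSemigroup ℕ) : 0 < w.content.card := by
  simp [content, letters]

/-- An endomorphism either makes a word more complex or acts on it as a renaming of letters. -/
theorem exceeds_hom_or_eq_smul (φ : FreeSemigroup ℕ →ₙ* FreeSemigroup ℕ) (u : FreeSemigroup ℕ) :
    Exceeds u.content.card u.content.toFinset.card (φ u).content ∨
      ∃ σ : Equiv.Perm ℕ, ∀ v : FreeSemigroup ℕ, v.content = u.content → φ v = σ • v := by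
  by_cases h : ∃ i ∈ u.content, 1 < (φ (of i)).content.card
  · left; left
    rw [content_hom, Multiset.card_bind]
    calc u.content.card = (u.content.map fun _ => 1).sum := by simp
      _ < _ := Multiset.sum_lt_sum (fun i _ => card_content_pos _) h
  push Not at h
  have hf : ∀ i ∈ u.content, (φ (of i)).letters = [(φ (of i)).head] := by
    intro i hi
    have := h i hi
    have h2 : (φ (of i)).tail = [] := by
      simpa [content, letters] using this
    rw [letters, h2]
  set f : ℕ → ℕ := fun i => (φ (of i)).head with hfdef
  have hc : (φ u).content = u.content.map f := by
    rw [content_hom, ← Multiset.bind_singleton]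
    refine Multiset.bind_congr fun i hi => ?_
    rw [content, hf i hi]
    rfl
  -- Letters now go to letters. Either `f` merges two of them, or it is injective on the content and
  -- extends to a permutation.
  rcases (Finset.card_image_le (s := u.content.toFinset) (f := f)).lt_or_eq with hlt | heq
  · left; right
    rw [hc, Multiset.card_map, Multiset.toFinset_map]
    exact ⟨rfl, hlt⟩
  · right
    have hinj := Finset.card_image_iff.1 heq
    have hl := u.content.toFinset.nodup_toList
    obtain ⟨σ, hσ⟩ := hl.exists_perm_map_eq (l' := u.content.toFinset.toList.map f)
      (hl.map_on fun x hx y hy hxy => hinj (by simpa using hx) (by simpa using hy) hxy) (by simp)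
    refine ⟨σ, fun v hv => letters_injective ?_⟩
    rw [letters_hom, letters_smul]
    have : ∀ i ∈ v.letters, (φ (of i)).letters = [σ i] := by
      intro i hi
      have hi : i ∈ u.content := by rw [← hv]; exact hi
      have h3 : σ i = f i := List.map_inj_left.1 hσ i (by simpa using hi)
      rw [hf i hi, h3]
    rw [List.flatMap_congr this]
    generalize v.letters = l
    induction l <;> simp_all

theorem Exceeds.hom {n k : ℕ} {u : FreeSemigroup ℕ} (h : Exceeds n k u.content)
    (φ : FreeSemigroup ℕ →ₙ* FreeSemigroup ℕ) : Exceeds n k (φ u).content := by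
  rcases exceeds_hom_or_eq_smul φ u with h' | ⟨σ, hσ⟩
  · unfold Exceeds at *
    omega
  · rwa [hσ u rfl, exceeds_smul_iff]

/-- `X` preserves the content, is invariant under renamings, and is concentrated on the words with
`n` letters of which `k` are distinct. -/
structure IsHomogeneous (n k : ℕ) (X : Setoid (FreeSemigroup ℕ)) : Prop where
  content : X ≤ Setoid.ker content
  smul : ∀ (σ : Equiv.Perm ℕ) {u v}, X u v → X (σ • u) (σ • v)
  eq_or : ∀ {u v}, X u v → u = v ∨ u.content.card = n ∧ u.content.toFinset.card = k

/-- Join `X` with the relation that identifies all words of the same content that exceed `(n, k)`. -/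
def expand (n k : ℕ) (X : Setoid (FreeSemigroup ℕ)) (hX : X ≤ Setoid.ker content) :
    Setoid (FreeSemigroup ℕ) where
  r u v := X u v ∨ u.content = v.content ∧ Exceeds n k u.content
  iseqv := by
    refine ⟨fun u => Or.inl (X.refl' u), ?_, ?_⟩
    · rintro u v (h | ⟨h, h'⟩)
      · exact Or.inl (X.symm' h)
      · exact Or.inr ⟨h.symm, h ▸ h'⟩
    · rintro u v w (h | ⟨h, h'⟩) (g | ⟨g, g'⟩)
      · exact Or.inl (X.trans' h g)
      · have h : u.content = v.content := hX h
        exact Or.inr ⟨h.trans g, h ▸ g'⟩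
      · have g : v.content = w.content := hX g
        exact Or.inr ⟨h.trans g, h'⟩
      · exact Or.inr ⟨h.trans g, h'⟩

variable {n k : ℕ} {X Y Z : Setoid (FreeSemigroup ℕ)}

theorem le_expand (hX : X ≤ Setoid.ker content) : X ≤ expand n k X hX := fun _ _ h => Or.inl h

theorem expand_le_ker (hX : X ≤ Setoid.ker content) : expand n k X hX ≤ Setoid.ker content := by
  rintro u v (h | ⟨h, -⟩)
  exacts [hX h, h]

theorem not_exceeds {w : FreeSemigroup ℕ} (h : w.content.card = n ∧ w.content.toFinset.card = k) :
    ¬ Exceeds n k w.content := by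
  unfold Exceeds
  omega

theorem of_expand {hX : X ≤ Setoid.ker content} {u v : FreeSemigroup ℕ}
    (hu : u.content.card = n ∧ u.content.toFinset.card = k) (h : expand n k X hX u v) : X u v :=
  h.resolve_right fun h' => not_exceeds hu h'.2

/-- Multiplication pushes nontrivial pairs beyond length `n`, where everything of equal content is
collapsed; an endomorphism does the same or acts as a renaming. -/
theorem IsHomogeneous.isFullyInvariant (hX : IsHomogeneous n k X) :
    IsFullyInvariant (expand n k X hX.content) := by
  have key : ∀ u v w : FreeSemigroup ℕ, expand n k X hX.content u v →
      u = v ∨ (u.content = v.content ∧ n < u.content.card + w.content.card) := by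
    intro u v w h
    have hw := card_content_pos w
    rcases h with h | ⟨h, h'⟩
    · refine (hX.eq_or h).imp_right fun h' => ⟨hX.content h, by omega⟩
    · refine Or.inr ⟨h, ?_⟩
      unfold Exceeds at h'
      omega
  refine ⟨fun w u v h => ?_, fun w u v h => ?_, fun φ u v h => ?_⟩
  · rcases key u v w h with rfl | ⟨h, h'⟩
    · exact Setoid.refl' _ _
    · refine Or.inr ⟨by simp [content_mul, h], Or.inl ?_⟩
      rw [content_mul, Multiset.card_add]
      omega
  · rcases key u v w h with rfl | ⟨h, h'⟩
    · exact Setoid.refl' _ _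
    · refine Or.inr ⟨by simp [content_mul, h], Or.inl ?_⟩
      rwa [content_mul, Multiset.card_add]
  · have hc : u.content = v.content := expand_le_ker _ h
    have hc' : (φ u).content = (φ v).content := by rw [content_hom, content_hom, hc]
    rcases h with h | ⟨h, h'⟩
    · rcases hX.eq_or h with rfl | ⟨rfl, rfl⟩
      · exact Setoid.refl' _ _
      rcases exceeds_hom_or_eq_smul φ u with h' | ⟨σ, hσ⟩
      · exact Or.inr ⟨hc', h'⟩
      · refine Or.inl ?_
        rw [hσ u rfl, hσ v hc.symm]
        exact hX.smul σ h
    · exact Or.inr ⟨hc', h'.hom φ⟩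

theorem IsHomogeneous.exists_idRel_eq (hX : IsHomogeneous n k X) :
    ∃ W : OC.{u}, idRel W = expand n k X hX.content :=
  OC.exists_idRel_eq hX.isFullyInvariant (expand_le_ker _)

theorem expand_le_sup_expand {T : Setoid (FreeSemigroup ℕ)} (hX : X ≤ Setoid.ker content)
    (hY : Y ≤ Setoid.ker content) (h : X ≤ T ⊔ Y) : expand n k X hX ≤ T ⊔ expand n k Y hY := by
  rintro u v (huv | huv)
  · exact sup_le_sup_left (le_expand hY) T (h huv)
  · exact (le_sup_right : expand n k Y hY ≤ _) (Or.inr huv)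

theorem inf_expand_le_expand {T : Setoid (FreeSemigroup ℕ)} (hX : X ≤ Setoid.ker content)
    (hY : Y ≤ Setoid.ker content) (h : T ⊓ X ≤ Y) : T ⊓ expand n k X hX ≤ expand n k Y hY := by
  rintro u v ⟨hT, huv | huv⟩
  · exact Or.inl (h ⟨hT, huv⟩)
  · exact Or.inr huv

variable {V : OC.{u}}

theorem not_isCancellableElement (hY : IsHomogeneous n k Y) (hZ : IsHomogeneous n k Z)
    (hYZ : Y ≤ idRel V ⊔ Z) (hZY : Z ≤ idRel V ⊔ Y) (hY' : idRel V ⊓ Y ≤ Z)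
    (hZ' : idRel V ⊓ Z ≤ Y) {a c : FreeSemigroup ℕ} (hac : Y a c) (hac' : ¬ Z a c) :
    ¬ IsCancellableElement V := by
  intro h
  obtain ⟨y, hy⟩ := hY.exists_idRel_eq
  obtain ⟨z, hz⟩ := hZ.exists_idRel_eq
  have hyz : y = z := by
    refine h y z (idRel_injective ?_) (idRel_injective ?_)
    · rw [idRel_sup, idRel_sup, hy, hz]
      exact le_antisymm (le_inf inf_le_left (inf_expand_le_expand _ _ hY'))
        (le_inf inf_le_left (inf_expand_le_expand _ _ hZ'))
    · rw [idRel_inf, idRel_inf, hy, hz]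
      exact le_antisymm (sup_le le_sup_left (expand_le_sup_expand _ _ hYZ))
        (sup_le le_sup_left (expand_le_sup_expand _ _ hZY))
  have h1 : expand n k Z hZ.content a c := by
    rw [← hz, ← hyz, hy]
    exact Or.inl hac
  rcases hY.eq_or hac with rfl | ha
  · exact hac' (Z.refl' _)
  · exact hac' (of_expand ha h1)

/-- On identities the law reads `V ⊔ (Y ⊓ Z) = (V ⊔ Y) ⊓ (V ⊔ Z)`; at level `(n, k)` the left side
is just `V`. -/
theorem not_isCodistributiveElement (hY : IsHomogeneous n k Y) (hZ : IsHomogeneous n k Z)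
    (hYZ : Y ⊓ Z ≤ idRel V) {a c : FreeSemigroup ℕ}
    (ha : a.content.card = n ∧ a.content.toFinset.card = k) (hY' : (idRel V ⊔ Y) a c)
    (hZ' : (idRel V ⊔ Z) a c) (hV : ¬ idRel V a c) : ¬ IsCodistributiveElement V := by
  intro h
  obtain ⟨y, hy⟩ := hY.exists_idRel_eq
  obtain ⟨z, hz⟩ := hZ.exists_idRel_eq
  have := congrArg idRel (h y z)
  rw [idRel_sup, idRel_inf, idRel_sup, idRel_inf, idRel_inf, hy, hz] at this
  have h1 : idRel V ⊔ expand n k Y hY.content ⊓ expand n k Z hZ.content ≤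
      expand n k (idRel V) (idRel_le V) := by
    refine sup_le (le_expand _) ?_
    rintro u v ⟨h1 | h1, h2 | h2⟩
    exacts [Or.inl (hYZ ⟨h1, h2⟩), Or.inr h2, Or.inr h1, Or.inr h1]
  refine hV (of_expand ha (h1 ?_))
  rw [this]
  exact ⟨sup_le_sup_left (le_expand _) _ hY', sup_le_sup_left (le_expand _) _ hZ'⟩

/-- On identities the law reads `V ⊓ (Y ⊔ Z) = (V ⊓ Y) ⊔ (V ⊓ Z)`; at level `(n, k)`, `X` bounds the
right side and misses `(p, q)`. -/
theorem not_isDistributiveElement (hY : IsHomogeneous n k Y) (hZ : IsHomogeneous n k Z)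
    (hX : X ≤ Setoid.ker content) (hY' : idRel V ⊓ Y ≤ X) (hZ' : idRel V ⊓ Z ≤ X)
    {p q : FreeSemigroup ℕ} (hp : p.content.card = n ∧ p.content.toFinset.card = k)
    (hV : idRel V p q) (hYZ : (Y ⊔ Z) p q) (hpq : ¬ X p q) : ¬ IsDistributiveElement V := by
  intro h
  obtain ⟨y, hy⟩ := hY.exists_idRel_eq
  obtain ⟨z, hz⟩ := hZ.exists_idRel_eq
  have := congrArg idRel (h y z)
  rw [idRel_sup, idRel_inf, idRel_inf, idRel_sup, idRel_sup, hy, hz] at this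
  refine hpq (of_expand hp ((sup_le (inf_expand_le_expand hY.content hX hY')
    (inf_expand_le_expand hZ.content hX hZ')) ?_))
  rw [← this]
  exact ⟨hV, sup_le_sup (le_expand _) (le_expand _) hYZ⟩

/-- The renaming-invariant equivalence generated by the pair `(a, c)`. -/
def pairSetoid (a c : FreeSemigroup ℕ) (hac : a.content = c.content)
    (h : ∀ σ : Equiv.Perm ℕ, σ • a = c → σ • c = a) : Setoid (FreeSemigroup ℕ) where
  r u v := u = v ∨ ∃ σ : Equiv.Perm ℕ, (u = σ • a ∧ v = σ • c) ∨ (u = σ • c ∧ v = σ • a)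
  iseqv := by
    -- Renamed copies of the pair that share a word coincide as unordered pairs, so classes have at
    -- most two elements.
    have h' : ∀ σ τ : Equiv.Perm ℕ, σ • a = τ • c → σ • c = τ • a := by
      intro σ τ hστ
      have := h (τ⁻¹ * σ) (by rw [mul_smul, hστ, inv_smul_smul])
      rwa [mul_smul, inv_smul_eq_iff] at this
    refine ⟨fun u => Or.inl rfl, ?_, ?_⟩
    · rintro u v (rfl | ⟨σ, hσ⟩)
      · exact Or.inl rfl
      · exact Or.inr ⟨σ, hσ.symm.imp And.symm And.symm⟩
    · rintro u v w (rfl | ⟨σ, ⟨rfl, rfl⟩ | ⟨rfl, rfl⟩⟩) (rfl | ⟨τ, ⟨h1, rfl⟩ | ⟨h1, rfl⟩⟩)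
      · exact Or.inl rfl
      · exact Or.inr ⟨τ, Or.inl ⟨h1, rfl⟩⟩
      · exact Or.inr ⟨τ, Or.inr ⟨h1, rfl⟩⟩
      · exact Or.inr ⟨σ, Or.inl ⟨rfl, rfl⟩⟩
      · exact Or.inl (h' _ _ h1.symm).symm
      · exact Or.inl (smul_eq_smul_of_content_eq hac.symm h1)
      · exact Or.inr ⟨σ, Or.inr ⟨rfl, rfl⟩⟩
      · exact Or.inl (smul_eq_smul_of_content_eq hac h1)
      · exact Or.inl (h' _ _ h1)

variable {a b c d : FreeSemigroup ℕ} {hac : a.content = c.content}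
  {h : ∀ σ : Equiv.Perm ℕ, σ • a = c → σ • c = a} {hbd : b.content = d.content}
  {h' : ∀ σ : Equiv.Perm ℕ, σ • b = d → σ • d = b}

theorem pairSetoid_self : pairSetoid a c hac h a c := Or.inr ⟨1, by simp⟩

theorem isHomogeneous_pairSetoid :
    IsHomogeneous a.content.card a.content.toFinset.card (pairSetoid a c hac h) where
  content := by
    rintro u v (rfl | ⟨σ, ⟨rfl, rfl⟩ | ⟨rfl, rfl⟩⟩) <;> simp [Setoid.ker_def, content_smul, hac]
  smul τ u v := by
    rintro (rfl | ⟨σ, ⟨rfl, rfl⟩ | ⟨rfl, rfl⟩⟩)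
    · exact Or.inl rfl
    · exact Or.inr ⟨τ * σ, by simp [mul_smul]⟩
    · exact Or.inr ⟨τ * σ, by simp [mul_smul]⟩
  eq_or {u v} := by
    rintro (rfl | ⟨σ, ⟨rfl, rfl⟩ | ⟨rfl, rfl⟩⟩)
    · exact Or.inl rfl
    · exact Or.inr ⟨by simp [content_smul], card_toFinset_content_smul _ _⟩
    · exact Or.inr ⟨by simp [content_smul, hac], by rw [hac]; exact card_toFinset_content_smul _ _⟩

/-- A renaming-invariant equivalence contains `pairSetoid a c` as soon as it relates `a` and `c`. -/
theorem pairSetoid_le (hX : ∀ (σ : Equiv.Perm ℕ) {u v}, X u v → X (σ • u) (σ • v)) (hx : X a c) :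
    pairSetoid a c hac h ≤ X := by
  rintro u v (rfl | ⟨σ, ⟨rfl, rfl⟩ | ⟨rfl, rfl⟩⟩)
  exacts [X.refl' _, hX σ hx, X.symm' (hX σ hx)]

theorem inf_pairSetoid_le (hX : ∀ (σ : Equiv.Perm ℕ) {u v}, X u v → X (σ • u) (σ • v))
    (hx : ¬ X a c) : X ⊓ pairSetoid a c hac h ≤ ⊥ := by
  have key : ∀ σ : Equiv.Perm ℕ, ¬ X (σ • a) (σ • c) := fun σ hσ =>
    hx (by simpa using hX σ⁻¹ hσ)
  rintro u v ⟨huv, rfl | ⟨σ, ⟨rfl, rfl⟩ | ⟨rfl, rfl⟩⟩⟩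
  exacts [rfl, absurd huv (key σ), absurd (X.symm' huv) (key σ)]

theorem sup_smul (hX : ∀ (σ : Equiv.Perm ℕ) {u v}, X u v → X (σ • u) (σ • v))
    (hY : ∀ (σ : Equiv.Perm ℕ) {u v}, Y u v → Y (σ • u) (σ • v)) (σ : Equiv.Perm ℕ)
    {u v : FreeSemigroup ℕ} (huv : (X ⊔ Y) u v) : (X ⊔ Y) (σ • u) (σ • v) := by
  have : X ⊔ Y ≤ (X ⊔ Y).comap (σ • ·) :=
    sup_le (fun _ _ h => (le_sup_left : X ≤ X ⊔ Y) (hX σ h))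
      (fun _ _ h => (le_sup_right : Y ≤ X ⊔ Y) (hY σ h))
  exact this huv

theorem idRel_smul (V : OC.{u}) (σ : Equiv.Perm ℕ) {u v : FreeSemigroup ℕ} (h : idRel V u v) :
    idRel V (σ • u) (σ • v) :=
  (isFullyInvariant_idRel V).hom (FreeSemigroup.map σ) h

/-- Two pairs `(a, c)` and `(b, d)` that coincide modulo the identities of `V`, but generate
different relations, witness that `V` is neither cancellable nor codistributive. -/
theorem not_isCancellableElement_and_not_isCodistributiveElement (hac : a.content = c.content)
    (h : ∀ σ : Equiv.Perm ℕ, σ • a = c → σ • c = a)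
    (h' : ∀ σ : Equiv.Perm ℕ, σ • b = d → σ • d = b) (hab : idRel V a b) (hcd : idRel V c d)
    (hV : ¬ idRel V a c) (hne : ¬ pairSetoid a c hac h b d) :
    ¬ IsCancellableElement V ∧ ¬ IsCodistributiveElement V := by
  have hbd : b.content = d.content :=
    (content_eq V hab).symm.trans (hac.trans (content_eq V hcd))
  have hV' : ¬ idRel V b d := fun hbd =>
    hV ((idRel V).trans' hab ((idRel V).trans' hbd ((idRel V).symm' hcd)))
  have hY : IsHomogeneous a.content.card a.content.toFinset.card (pairSetoid a c hac h) :=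
    isHomogeneous_pairSetoid
  have hZ : IsHomogeneous a.content.card a.content.toFinset.card (pairSetoid b d hbd h') := by
    rw [content_eq V hab]
    exact isHomogeneous_pairSetoid
  set Y := pairSetoid a c hac h with hYdef
  set Z := pairSetoid b d hbd h' with hZdef
  have lV : idRel V ≤ idRel V ⊔ Z := le_sup_left
  have lV' : idRel V ≤ idRel V ⊔ Y := le_sup_left
  have lY : Y ≤ idRel V ⊔ Y := le_sup_right
  have lZ : Z ≤ idRel V ⊔ Z := le_sup_right
  -- The path is `a`, `b`, `d`, `c`, alternating between `V` and `Z`.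
  have h1 : (idRel V ⊔ Z) a c :=
    Setoid.trans' _ (lV hab) (Setoid.trans' _ (lZ pairSetoid_self)
      (lV ((idRel V).symm' hcd)))
  have h2 : (idRel V ⊔ Y) b d :=
    Setoid.trans' _ (lV' ((idRel V).symm' hab)) (Setoid.trans' _ (lY pairSetoid_self) (lV' hcd))
  have hYZ : Y ⊓ Z ≤ ⊥ := inf_pairSetoid_le hY.smul hne
  refine ⟨?_, ?_⟩
  · refine not_isCancellableElement hY hZ
      (pairSetoid_le (sup_smul (idRel_smul V) hZ.smul) h1)
      (pairSetoid_le (sup_smul (idRel_smul V) hY.smul) h2)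
      ((inf_pairSetoid_le (idRel_smul V) hV).trans bot_le)
      ((inf_pairSetoid_le (idRel_smul V) hV').trans bot_le) (a := a) (c := c) pairSetoid_self ?_
    intro hac'
    have : a = c := hYZ ⟨pairSetoid_self, hac'⟩
    exact hV (this ▸ (idRel V).refl' a)
  · exact not_isCodistributiveElement hY hZ (hYZ.trans bot_le) ⟨rfl, rfl⟩ (lY pairSetoid_self) h1 hV

end FreeSemigroup

namespace FreeSemigroup

variable {V : OC.{u}}

/-! ### Contents with a repeated letter. -/

section ManyOrbits

/-- The pairs `(a, c)` and `(b, c)` generate different relations: a renaming fixing `c` fixes `a`.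
Their join relates `a` to `b`, although each meets `V` trivially, which refutes distributivity. -/
theorem not_special_of_not_mem_orbit {a b c : FreeSemigroup ℕ} (hab : idRel V a b) (hne : a ≠ b)
    (hac : a.content = c.content) (hV : ¬ idRel V a c) (ha : ∀ σ : Equiv.Perm ℕ, σ • a ≠ c)
    (hb : ∀ σ : Equiv.Perm ℕ, σ • b ≠ c) :
    ¬ IsCancellableElement V ∧ ¬ IsCodistributiveElement V ∧ ¬ IsDistributiveElement V := by
  have h1 : ∀ σ : Equiv.Perm ℕ, σ • a = c → σ • c = a := fun σ h => absurd h (ha σ)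
  have h2 : ∀ σ : Equiv.Perm ℕ, σ • b = c → σ • c = b := fun σ h => absurd h (hb σ)
  have hbc : b.content = c.content := (content_eq V hab).symm.trans hac
  have hV' : ¬ idRel V b c := fun h => hV ((idRel V).trans' hab h)
  obtain ⟨r1, r2⟩ := not_isCancellableElement_and_not_isCodistributiveElement hac h1 h2 hab
    ((idRel V).refl' c) hV (by
      rintro (rfl | ⟨σ, ⟨h, h'⟩ | ⟨h, h'⟩⟩)
      · exact hV hab
      · refine hne ?_
        have h3 : σ • c = (1 : Equiv.Perm ℕ) • c := by rw [one_smul, ← h']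
        have h4 := smul_eq_smul_of_content_eq hac.symm h3
        rw [h, h4, one_smul]
      · exact hb σ⁻¹ (by rw [h, inv_smul_smul]))
  refine ⟨r1, r2, ?_⟩
  have hY : IsHomogeneous a.content.card a.content.toFinset.card (pairSetoid a c hac h1) :=
    isHomogeneous_pairSetoid
  have hZ : IsHomogeneous a.content.card a.content.toFinset.card (pairSetoid b c hbc h2) := by
    rw [content_eq V hab]
    exact isHomogeneous_pairSetoid
  refine not_isDistributiveElement hY hZ (X := ⊥) bot_le (inf_pairSetoid_le (idRel_smul V) hV)
    (inf_pairSetoid_le (idRel_smul V) hV') ⟨rfl, rfl⟩ hab ?_ hne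
  exact Setoid.trans' _
    ((le_sup_left : pairSetoid a c hac h1 ≤ pairSetoid a c hac h1 ⊔ pairSetoid b c hbc h2)
      pairSetoid_self)
    (Setoid.symm' _ ((le_sup_right :
      pairSetoid b c hbc h2 ≤ pairSetoid a c hac h1 ⊔ pairSetoid b c hbc h2) pairSetoid_self))

/-- If `s` has at least three classes and every pair of distinct `r`-related elements is related to
everything outside of their `s`-classes, then `r` is trivial. -/
theorem rel_of_three_classes {α : Type*} {r s : Setoid α} {w₁ w₂ w₃ : α} (h₁₂ : ¬ s w₁ w₂)
    (h₁₃ : ¬ s w₁ w₃) (h₂₃ : ¬ s w₂ w₃)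
    (h : ∀ a b c, r a b → a ≠ b → ¬ s a c → ¬ s b c → r a c) {a b : α} (hab : r a b)
    (hne : a ≠ b) (c : α) : r a c := by
  have tr : ∀ {x y z}, s x y → s x z → s y z := fun h h' => s.trans' (s.symm' h) h'
  have tr' : ∀ {x y z}, s x z → s y z → s x y := fun h h' => s.trans' h (s.symm' h')
  have ne : ∀ {x y}, ¬ s x y → x ≠ y := fun h e => h (e ▸ s.refl' _)
  -- The `r`-class of `a` meets three `s`-classes; any `c` avoids two of them, and `h` applies to
  -- those two.
  have triple : ∃ p q t, r a p ∧ r a q ∧ r a t ∧ ¬ s p q ∧ ¬ s p t ∧ ¬ s q t := by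
    by_cases hs : s a b
    · have two : ∀ u v, ¬ s u v → ¬ s a u → ¬ s a v →
          ∃ p q t, r a p ∧ r a q ∧ r a t ∧ ¬ s p q ∧ ¬ s p t ∧ ¬ s q t := fun u v huv hu hv =>
        ⟨a, u, v, r.refl' a, h a b u hab hne hu fun h' => hu (s.trans' hs h'),
          h a b v hab hne hv fun h' => hv (s.trans' hs h'), hu, hv, huv⟩
      by_cases k1 : s a w₁
      · exact two w₂ w₃ h₂₃ (fun k => h₁₂ (tr k1 k)) (fun k => h₁₃ (tr k1 k))
      · by_cases k2 : s a w₂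
        · exact two w₁ w₃ h₁₃ k1 (fun k => h₂₃ (tr k2 k))
        · exact two w₁ w₂ h₁₂ k1 k2
    · have one : ∀ u, ¬ s a u → ¬ s b u →
          ∃ p q t, r a p ∧ r a q ∧ r a t ∧ ¬ s p q ∧ ¬ s p t ∧ ¬ s q t := fun u hu hv =>
        ⟨a, b, u, r.refl' a, hab, h a b u hab hne hu hv, hs, hu, hv⟩
      by_cases k1 : s a w₁
      · by_cases k2 : s b w₂
        · exact one w₃ (fun k => h₁₃ (tr k1 k)) (fun k => h₂₃ (tr k2 k))
        · exact one w₂ (fun k => h₁₂ (tr k1 k)) k2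
      · by_cases k2 : s b w₁
        · by_cases k3 : s a w₂
          · exact one w₃ (fun k => h₂₃ (tr k3 k)) (fun k => h₁₃ (tr k2 k))
          · exact one w₂ k3 (fun k => h₁₂ (tr k2 k))
        · exact one w₁ k1 k2
  obtain ⟨p, q, t, hp, hq, ht, hpq, hpt, hqt⟩ := triple
  by_cases k1 : s p c
  · exact r.trans' hq (h q t c (r.trans' (r.symm' hq) ht) (ne hqt) (fun k => hpq (tr' k1 k))
      (fun k => hpt (tr' k1 k)))
  · by_cases k2 : s q c
    · exact r.trans' hp (h p t c (r.trans' (r.symm' hp) ht) (ne hpt) k1 (fun k => hqt (tr' k2 k)))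
    · exact r.trans' hp (h p q c (r.trans' (r.symm' hp) hq) (ne hpq) k1 k2)

theorem smul_ne_of_letters {u v : FreeSemigroup ℕ} {i j : ℕ} (hi : i < u.letters.length)
    (hj : j < u.letters.length) (hi' : i < v.letters.length) (hj' : j < v.letters.length)
    (h : u.letters[i] = u.letters[j]) (h' : v.letters[i] ≠ v.letters[j]) (σ : Equiv.Perm ℕ) :
    σ • u ≠ v := by
  rintro rfl
  simp [h] at h'

/-- The beginnings `xxy`, `xyx`, `yxx` differ in which positions carry equal letters, a renaming
invariant. -/
theorem exists_three_orbits {m : Multiset ℕ} {x y : ℕ} (hxy : x ≠ y) (hx : 2 ≤ m.count x)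
    (hy : y ∈ m) : ∃ w₁ w₂ w₃ : FreeSemigroup ℕ,
      w₁.content = m ∧ w₂.content = m ∧ w₃.content = m ∧ (∀ σ : Equiv.Perm ℕ, σ • w₁ ≠ w₂) ∧
      (∀ σ : Equiv.Perm ℕ, σ • w₁ ≠ w₃) ∧ ∀ σ : Equiv.Perm ℕ, σ • w₂ ≠ w₃ := by
  have hle : x ::ₘ x ::ₘ {y} ≤ m := by
    rw [Multiset.le_iff_count]
    intro z
    have hy' := Multiset.one_le_count_iff_mem.2 hy
    by_cases hzx : z = x
    · subst hzx
      simpa [Multiset.count_singleton, hxy] using hx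
    · by_cases hzy : z = y
      · subst hzy
        simpa [hzx] using hy'
      · simp [hzx, hzy]
  obtain ⟨R, rfl⟩ := Multiset.le_iff_exists_add.1 hle
  induction R using Quotient.inductionOn with
  | h R =>
    refine ⟨⟨x, x :: y :: R⟩, ⟨x, y :: x :: R⟩, ⟨y, x :: x :: R⟩, rfl, ?_, ?_, ?_, ?_, ?_⟩
    · exact Quotient.sound ((List.Perm.swap _ _ _).cons _)
    · exact Quotient.sound ((List.Perm.swap _ _ _).trans ((List.Perm.swap _ _ _).cons _))
    · exact fun σ => smul_ne_of_letters (i := 0) (j := 1) (by simp [letters]) (by simp [letters])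
        (by simp [letters]) (by simp [letters]) (by simp [letters]) (by simpa [letters] using hxy) σ
    · exact fun σ => smul_ne_of_letters (i := 0) (j := 1) (by simp [letters]) (by simp [letters])
        (by simp [letters]) (by simp [letters]) (by simp [letters])
        (by simpa [letters] using hxy.symm) σ
    · exact fun σ => smul_ne_of_letters (i := 0) (j := 2) (by simp [letters]) (by simp [letters])
        (by simp [letters]) (by simp [letters]) (by simp [letters])
        (by simpa [letters] using hxy.symm) σ

theorem not_special_of_not_nodup {a b c : FreeSemigroup ℕ} (hab : idRel V a b) (hne : a ≠ b)
    (hac : a.content = c.content) (hV : ¬ idRel V a c) (hnd : ¬ a.content.Nodup) :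
    ¬ IsCancellableElement V ∧ ¬ IsCodistributiveElement V ∧ ¬ IsDistributiveElement V := by
  obtain ⟨x, hx⟩ : ∃ x, 2 ≤ a.content.count x := by
    by_contra! h
    exact hnd (Multiset.nodup_iff_count_le_one.2 fun x => Nat.le_of_lt_succ (h x))
  have hab' := content_eq V hab
  obtain ⟨y, hy, hxy⟩ : ∃ y ∈ a.content, x ≠ y := by
    by_contra! h
    refine hne (letters_injective ?_)
    have h1 : ∀ y ∈ a.letters, y = x := fun y hy => (h y hy).symm
    have h2 : ∀ y ∈ b.letters, y = x := fun y hy => (h y (by rw [hab']; exact hy)).symm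
    rw [List.eq_replicate_of_mem h1, List.eq_replicate_of_mem h2,
      (content_eq_iff.1 hab').length_eq]
  obtain ⟨w₁, w₂, w₃, h1, h2, h3, h12, h13, h23⟩ := exists_three_orbits hxy hx hy
  by_contra hcon
  let s : Setoid {w : FreeSemigroup ℕ // w.content = a.content} :=
    (MulAction.orbitRel (Equiv.Perm ℕ) (FreeSemigroup ℕ)).comap Subtype.val
  have hs : ∀ {u v : {w : FreeSemigroup ℕ // w.content = a.content}},
      (∀ σ : Equiv.Perm ℕ, σ • u.1 ≠ v.1) ↔ ¬ s u v := by
    intro u v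
    have : s u v ↔ ∃ σ : Equiv.Perm ℕ, σ • v.1 = u.1 := Iff.rfl
    rw [this, not_exists]
    exact ⟨fun h σ e => h σ⁻¹ (by rw [← e, inv_smul_smul]),
      fun h σ e => h σ⁻¹ (by rw [← e, inv_smul_smul])⟩
  refine hV (rel_of_three_classes (r := component a.content V) (s := s) (w₁ := ⟨w₁, h1⟩)
    (w₂ := ⟨w₂, h2⟩) (w₃ := ⟨w₃, h3⟩) (hs.1 h12) (hs.1 h13) (hs.1 h23) ?_ (a := ⟨a, rfl⟩)
    (b := ⟨b, hab'.symm⟩) hab (fun h => hne (congrArg Subtype.val h)) ⟨c, hac.symm⟩)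
  intro p q t hpq hpq' hpt hqt
  by_contra hVpt
  exact hcon (not_special_of_not_mem_orbit hpq (fun h => hpq' (Subtype.ext h))
    (p.2.trans t.2.symm) hVpt (hs.2 hpt) (hs.2 hqt))

end ManyOrbits

/-! ### Contents without repeated letters. -/

section Multilinear

variable {e : FreeSemigroup ℕ} {h k : Equiv.Perm ℕ}

theorem content_swap_smul (he : e.content.Nodup) {p q : ℕ} (hp : p ∈ e.content)
    (hq : q ∈ e.content) : (Equiv.swap p q • e).content = e.content := by
  rw [content_smul]
  refine (Multiset.Nodup.ext (he.map (Equiv.swap p q).injective) he).2 fun i => ?_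
  rw [Multiset.mem_map]
  constructor
  · rintro ⟨j, hj, rfl⟩
    rw [Equiv.swap_apply_def]
    split_ifs <;> assumption
  · intro hi
    refine ⟨Equiv.swap p q i, ?_, by simp⟩
    rw [Equiv.swap_apply_def]
    split_ifs <;> assumption

theorem content_smul_smul {σ τ : Equiv.Perm ℕ} (hσ : (σ • e).content = e.content)
    (hτ : (τ • e).content = e.content) : (σ • τ • e).content = e.content := by
  rw [content_smul, hτ, ← content_smul, hσ]

theorem exists_smul_eq_of_nodup (he : e.content.Nodup) {w : FreeSemigroup ℕ}
    (hw : e.content = w.content) : ∃ σ : Equiv.Perm ℕ, σ • e = w := by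
  obtain ⟨σ, hσ⟩ := List.Nodup.exists_perm_map_eq (l := e.letters) (l' := w.letters) he
    ((content_eq_iff.1 hw).nodup_iff.1 he) (content_eq_iff.1 hw).length_eq
  exact ⟨σ, letters_injective (by simpa using hσ)⟩

theorem smul_content_of_nodup {σ : Equiv.Perm ℕ} {i : ℕ} (hσ : (σ • e).content = e.content)
    (hi : i ∈ e.content) : σ i ∈ e.content := by
  rw [← hσ, content_smul]
  exact Multiset.mem_map_of_mem _ hi

/-- Adjacent exchanges generate all rearrangements, and exchanging the letters `σ p`, `σ q` of `σ •
e` yields `σ • Equiv.swap p q • e`. -/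
theorem idRel_of_idRel_swap (he : e.content.Nodup)
    (H : ∀ p ∈ e.content, ∀ q ∈ e.content, idRel V e (Equiv.swap p q • e)) {w : FreeSemigroup ℕ}
    (hw : e.content = w.content) : idRel V e w := by
  have key : ∀ l₁ l₂ : List ℕ, l₁.Perm l₂ → ∀ (l : List ℕ) (u v : FreeSemigroup ℕ),
      u.letters = l ++ l₁ → v.letters = l ++ l₂ → e.content = u.content → idRel V u v := by
    intro l₁ l₂ hl
    induction hl with
    | nil =>
      intro l u v hu hv _
      rw [letters_injective (hu.trans hv.symm)]
    | @cons x l₁ l₂ _ ih =>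
      intro l u v hu hv
      exact ih (l ++ [x]) u v (by simpa using hu) (by simpa using hv)
    | swap x y l₁ =>
      intro l u v hu hv huc
      obtain ⟨σ, rfl⟩ := exists_smul_eq_of_nodup he huc
      have hnd : (l ++ y :: x :: l₁).Nodup := by
        rw [← hu]
        exact (content_eq_iff.1 huc).nodup_iff.1 he
      have hx : x ∈ (σ • e).content := by rw [content, hu]; simp
      have hy : y ∈ (σ • e).content := by rw [content, hu]; simp
      rw [content_smul, Multiset.mem_map] at hx hy
      obtain ⟨p, hp, rfl⟩ := hx
      obtain ⟨q, hq, rfl⟩ := hy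
      have : v = Equiv.swap (σ p) (σ q) • σ • e := by
        refine letters_injective ?_
        rw [letters_smul, hu, hv]
        simp only [List.nodup_append, List.nodup_cons, List.mem_cons] at hnd
        have fix : ∀ l' : List ℕ, σ p ∉ l' → σ q ∉ l' → l'.map (Equiv.swap (σ p) (σ q)) = l' := by
          intro l' h1 h2
          conv_rhs => rw [← List.map_id l']
          refine List.map_congr_left fun i hi => ?_
          exact Equiv.swap_apply_of_ne_of_ne (fun h => h1 (h ▸ hi)) (fun h => h2 (h ▸ hi))
        have h1 : σ p ∉ l := fun hm => hnd.2.2 _ hm _ (by simp) rfl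
        have h2 : σ q ∉ l := fun hm => hnd.2.2 _ hm _ (by simp) rfl
        have h3 : σ p ∉ l₁ := hnd.2.1.2.1
        have h4 : σ q ∉ l₁ := fun hm => hnd.2.1.1 (Or.inr hm)
        simp [fix l h1 h2, fix l₁ h3 h4]
      rw [this, ← mul_smul, ← Equiv.mul_swap_eq_swap_mul, mul_smul]
      exact idRel_smul V σ (H p hp q hq)
    | @trans l₁ l₂ l₃ h12 _ ih1 ih2 =>
      intro l u v hu hv huc
      obtain ⟨w, hw⟩ := exists_letters_eq (l := l ++ l₂) (by
        rw [← List.length_pos_iff, ((h12.append_left l).symm).length_eq, ← hu, List.length_pos_iff]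
        exact u.letters_ne_nil)
      have huw : u.content = w.content :=
        content_eq_iff.2 (by rw [hu, hw]; exact h12.append_left l)
      exact (idRel V).trans' (ih1 l u w hu hw huc) (ih2 l w v hw hv (huc.trans huw))
  exact key _ _ (content_eq_iff.1 hw) [] e w rfl rfl rfl

/-- Let `H` be the group of `σ` with `e` related to `σ • e`. If every transposition outside `H`
commuted with `h`, then `(p r) ∉ H` would force `h p ∈ {p, r}`. For `p` moved by `h`, all `(p r)`
with `r ≠ h p` then lie in `H`. If `(p (h p))` does too, `H` is everything; otherwise `h` acts as
this transposition, which puts it in `H`. -/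
theorem exists_swap_not_commute (he : e.content.Nodup) (hh : idRel V e (h • e)) (hne : h • e ≠ e)
    {w : FreeSemigroup ℕ} (hw : e.content = w.content) (hV : ¬ idRel V e w) :
    ∃ p ∈ e.content, ∃ q ∈ e.content, ¬ idRel V e (Equiv.swap p q • e) ∧
      h • Equiv.swap p q • e ≠ Equiv.swap p q • h • e := by
  by_contra! hcon
  have mul : ∀ {σ τ : Equiv.Perm ℕ}, idRel V e (σ • e) → idRel V e (τ • e) →
      idRel V e ((σ * τ) • e) := fun {σ τ} h1 h2 => by
    rw [mul_smul]
    exact (idRel V).trans' h1 (idRel_smul V σ h2)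
  have hself : ∀ p : ℕ, idRel V e (Equiv.swap p p • e) := fun p => by
    rw [Equiv.swap_self, show (Equiv.refl ℕ : Equiv.Perm ℕ) = 1 from rfl, one_smul]
  have swap_trans : ∀ p q r : ℕ, idRel V e (Equiv.swap p q • e) → idRel V e (Equiv.swap p r • e) →
      idRel V e (Equiv.swap q r • e) := by
    intro p q r h1 h2
    by_cases hqr : q = r
    · exact hqr ▸ hself q
    by_cases hpr : p = r
    · rw [Equiv.swap_comm, ← hpr]; exact h1
    have : Equiv.swap q r = Equiv.swap p q * Equiv.swap p r * Equiv.swap p q := by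
      rw [Equiv.swap_comm p r, Equiv.swap_mul_swap_mul_swap (Ne.symm hpr) (Ne.symm hqr)]
    rw [this]
    exact mul (mul h1 h2) h1
  have move : ∀ p ∈ e.content, ∀ q ∈ e.content, ¬ idRel V e (Equiv.swap p q • e) →
      h p = p ∨ h p = q := by
    intro p hp q hq hpq
    have hc := hcon p hp q hq hpq
    rw [← mul_smul, ← mul_smul, smul_eq_smul_iff] at hc
    have := hc p hp
    simp only [Equiv.Perm.mul_apply, Equiv.swap_apply_left] at this
    by_contra! hno
    rw [Equiv.swap_apply_of_ne_of_ne hno.1 hno.2] at this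
    exact hpq (h.injective this ▸ hself q)
  have hhe : (h • e).content = e.content := (content_eq V hh).symm
  obtain ⟨p, hp, hpne⟩ : ∃ p ∈ e.content, h p ≠ p := by
    by_contra! hfix
    refine hne ?_
    conv_rhs => rw [← one_smul (Equiv.Perm ℕ) e]
    exact smul_eq_smul_iff.2 hfix
  have hq := smul_content_of_nodup hhe hp
  have hnear : ∀ r ∈ e.content, r ≠ h p → idRel V e (Equiv.swap p r • e) := by
    intro r hr hrne
    by_contra hno
    rcases move p hp r hr hno with h1 | h1
    exacts [hpne h1, hrne h1.symm]
  by_cases hpq : idRel V e (Equiv.swap p (h p) • e)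
  · have hall : ∀ r ∈ e.content, idRel V e (Equiv.swap p r • e) := fun r hr => by
      by_cases hrq : r = h p
      · rwa [hrq]
      · exact hnear r hr hrq
    exact hV (idRel_of_idRel_swap he
      (fun r hr s hs => swap_trans p r s (hall r hr) (hall s hs)) hw)
  · have hhq : h (h p) = p := by
      rw [Equiv.swap_comm] at hpq
      rcases move _ hq p hp hpq with h1 | h1
      · exact absurd (h.injective h1) hpne
      · exact h1
    refine hpq ?_
    have : Equiv.swap p (h p) • e = h • e := by
      rw [smul_eq_smul_iff]
      intro r hr
      by_cases hrp : r = p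
      · rw [hrp, Equiv.swap_apply_left]
      by_cases hrq : r = h p
      · rw [hrq, Equiv.swap_apply_right, hhq]
      exfalso
      -- A third letter `r` cannot exist: `(p r)` and `((h p) r)` in `H` would give `(p (h p))`, so
      -- `h (h p)` would be `h p` or `r` instead of `p`.
      have hqr : ¬ idRel V e (Equiv.swap (h p) r • e) := fun hqr => hpq (by
        have h1 := hnear r hr hrq
        rw [Equiv.swap_comm] at h1 hqr
        exact swap_trans r p (h p) h1 hqr)
      rcases move _ hq r hr hqr with h1 | h1
      · exact hpne (h.injective h1)
      · exact hrp (h1.symm.trans hhq)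
    rwa [this]

/-- For `u = σ • e`: the class of `u` consists of the words `σ • g • e` where `g` commutes with `k`
on the letters of `e`. -/
def centralizerSetoid (e : FreeSemigroup ℕ) (k : Equiv.Perm ℕ) :
    Setoid (FreeSemigroup ℕ) where
  r u v := u = v ∨ ∃ σ g : Equiv.Perm ℕ, (g • e).content = e.content ∧ g • k • e = k • g • e ∧
    u = σ • e ∧ v = σ • g • e
  iseqv := by
    have mv : ∀ {g : Equiv.Perm ℕ} {f : FreeSemigroup ℕ}, g • k • e = k • g • e →
        e.content = f.content → g • k • f = k • g • f := by
      intro g f hg hf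
      rw [← mul_smul, ← mul_smul] at hg ⊢
      exact smul_eq_smul_of_content_eq hf hg
    refine ⟨fun u => Or.inl rfl, ?_, ?_⟩
    · rintro u v (rfl | ⟨σ, g, hg, hgk, rfl, rfl⟩)
      · exact Or.inl rfl
      have hg' : (g⁻¹ • e).content = e.content := by
        conv_lhs => rw [content_smul, ← hg, ← content_smul, inv_smul_smul]
      refine Or.inr ⟨σ * g, g⁻¹, hg', ?_, by rw [mul_smul], by rw [mul_smul, smul_inv_smul]⟩
      have := mv hgk hg'.symm
      rw [smul_inv_smul] at this
      rw [← this, inv_smul_smul]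
    · rintro u v w (rfl | ⟨σ, g, hg, hgk, rfl, rfl⟩) (rfl | ⟨τ, f, hf, hfk, h1, rfl⟩)
      · exact Or.inl rfl
      · exact Or.inr ⟨τ, f, hf, hfk, h1, rfl⟩
      · exact Or.inr ⟨σ, g, hg, hgk, rfl, rfl⟩
      · refine Or.inr ⟨σ, g * f, ?_, ?_, rfl, ?_⟩
        · rw [mul_smul]
          exact content_smul_smul hg hf
        · rw [mul_smul, mul_smul, hfk, mv hgk hf.symm]
        · rw [← mul_smul] at h1
          rw [← smul_eq_smul_of_content_eq hf.symm h1, mul_smul, mul_smul]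

theorem isHomogeneous_centralizerSetoid :
    IsHomogeneous e.content.card e.content.toFinset.card (centralizerSetoid e k) where
  content := by
    rintro u v (rfl | ⟨σ, g, hg, -, rfl, rfl⟩)
    · exact Setoid.refl' _ _
    · rw [Setoid.ker_def, content_smul, content_smul σ (g • e), hg]
  smul τ u v := by
    rintro (rfl | ⟨σ, g, hg, hgk, rfl, rfl⟩)
    · exact Or.inl rfl
    · exact Or.inr ⟨τ * σ, g, hg, hgk, by rw [mul_smul], by rw [mul_smul]⟩
  eq_or {u v} := by
    rintro (rfl | ⟨σ, g, hg, -, rfl, rfl⟩)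
    · exact Or.inl rfl
    · exact Or.inr ⟨by simp [content_smul], card_toFinset_content_smul _ _⟩

/-- With `b = h • a` and `t` the transposition found above, the pairs `(a, t • a)` and `(h • a, t •
h • a)` generate different relations because `t` and `h` do not commute on `a`. -/
theorem not_special_of_nodup {a b c : FreeSemigroup ℕ} (hab : idRel V a b) (hne : a ≠ b)
    (hac : a.content = c.content) (hV : ¬ idRel V a c) (ha : a.content.Nodup) :
    ¬ IsCancellableElement V ∧ ¬ IsCodistributiveElement V ∧ ¬ IsDistributiveElement V := by
  obtain ⟨h, rfl⟩ := exists_smul_eq_of_nodup ha (content_eq V hab)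
  obtain ⟨p, hp, q, hq, hpq, hcomm⟩ := exists_swap_not_commute ha hab hne.symm hac hV
  have hat := (content_swap_smul ha hp hq).symm
  have hah := content_eq V hab
  have htt : ∀ w : FreeSemigroup ℕ, Equiv.swap p q • Equiv.swap p q • w = w := fun w => by
    rw [← mul_smul, Equiv.swap_mul_self, one_smul]
  generalize Equiv.swap p q = t at *
  have mv : ∀ {σ τ : Equiv.Perm ℕ} {f g : FreeSemigroup ℕ}, f.content = g.content →
      σ • f = τ • f → σ • g = τ • g := smul_eq_smul_of_content_eq
  have hat' : (h • a).content = (t • h • a).content := by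
    rw [content_smul t (h • a), ← hah, ← content_smul]
    exact hat
  have h1 : ∀ σ : Equiv.Perm ℕ, σ • a = t • a → σ • t • a = a := fun σ hσ => by
    rw [mv hat hσ, htt]
  have h2 : ∀ σ : Equiv.Perm ℕ, σ • h • a = t • h • a → σ • t • h • a = h • a := fun σ hσ => by
    rw [mv hat' hσ, htt]
  have hta : idRel V (t • a) (t • h • a) := idRel_smul V t hab
  obtain ⟨r1, r2⟩ := not_isCancellableElement_and_not_isCodistributiveElement hat h1 h2 hab hta hpq
    (by
      rintro (h3 | ⟨σ, ⟨h3, h4⟩ | ⟨h3, h4⟩⟩)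
      · exact hpq ((idRel V).trans' hab (h3 ▸ (idRel V).symm' hta))
      · exact hcomm (by rw [h4, mv hat h3])
      · rw [← mul_smul] at h3
        exact hcomm (by rw [h4, mv hat h3, mul_smul, htt]))
  refine ⟨r1, r2, ?_⟩
  have hk : ((t * h) • a).content = a.content := by
    rw [mul_smul]
    exact content_smul_smul hat.symm hah.symm
  have hY : IsHomogeneous a.content.card a.content.toFinset.card (pairSetoid a (t • a) hat h1) :=
    isHomogeneous_pairSetoid
  have hZ := isHomogeneous_centralizerSetoid (e := a) (k := t * h)
  set Y := pairSetoid a (t • a) hat h1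
  set Z := centralizerSetoid a (t * h)
  -- `Y` leads from `a` to `t • a` and `Z` on to `t • (t * h) • a = h • a`. But `Z` alone relates
  -- `a` to `h • a` only if `h` commutes with `t * h`, hence with `t`.
  refine not_isDistributiveElement hY hZ (X := idRel V ⊓ Z) (inf_le_left.trans (idRel_le V))
    ((inf_pairSetoid_le (idRel_smul V) hpq).trans bot_le) le_rfl ⟨rfl, rfl⟩ hab ?_ ?_
  · have l1 : Y ≤ Y ⊔ Z := le_sup_left
    have l2 : Z ≤ Y ⊔ Z := le_sup_right
    refine Setoid.trans' _ (l1 pairSetoid_self) (l2 (Or.inr ⟨t, t * h, hk, rfl, rfl, ?_⟩))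
    rw [mul_smul, htt]
  · rintro ⟨-, h3 | ⟨σ, g, hg, hgk, h4, h5⟩⟩
    · exact hne h3
    · have hσ : σ • a = (1 : Equiv.Perm ℕ) • a := by rw [one_smul, ← h4]
      rw [mv hg.symm hσ, one_smul] at h5
      have h6 : h • (t * h) • a = (t * h) • h • a := by
        rw [mv hk.symm h5, hgk, h5]
      rw [mul_smul, mul_smul, ← mul_smul, ← mul_smul t] at h6
      have := mv hah.symm h6
      rw [mul_smul, mul_smul] at this
      exact hcomm this

end Multilinear

theorem not_special_of_not_isTrivialOnContents (h : ¬ IsTrivialOnContents V) :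
    ¬ IsCancellableElement V ∧ ¬ IsCodistributiveElement V ∧ ¬ IsDistributiveElement V := by
  unfold IsTrivialOnContents at h
  push Not at h
  obtain ⟨a, b, c, hab, hne, hac, hV⟩ := h
  by_cases ha : a.content.Nodup
  · exact not_special_of_nodup hab hne hac hV ha
  · exact not_special_of_not_nodup hab hne hac hV ha

end FreeSemigroup

theorem corollary2p3 (V : SemigroupVariety.OC.{u}) :
    List.TFAE
      [IsNeutralElement V,
       IsStandardElement V,
       IsCostandardElement V,
       IsDistributiveElement V,
       IsCodistributiveElement V,
       IsCancellableElement V] := by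
  have trivial_of : IsCancellableElement V ∨ IsCodistributiveElement V ∨ IsDistributiveElement V →
      IsNeutralElement V := fun h => by
    refine IsTrivialOnContents.isNeutral ?_
    by_contra hV
    have := not_special_of_not_isTrivialOnContents hV
    tauto
  tfae_have 1 → 2 := IsNeutralElement.isStandard
  tfae_have 1 → 3 := IsNeutralElement.isCostandard
  tfae_have 1 → 4 := IsNeutralElement.isDistributive
  tfae_have 1 → 5 := IsNeutralElement.isCodistributive
  tfae_have 2 → 6 := IsStandardElement.isCancellable
  tfae_have 3 → 6 := IsCostandardElement.isCancellable
  tfae_have 4 → 1 := fun h => trivial_of (Or.inr (Or.inr h))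
  tfae_have 5 → 1 := fun h => trivial_of (Or.inr (Or.inl h))
  tfae_have 6 → 1 := fun h => trivial_of (Or.inl h)
  tfae_finish
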